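/- Let $d\ge 1$, let $\mathbf n=(n_1,\dots,n_d)$ be a tuple of positive integers, let $\rho\in[d]=\{1,\dots,d\}$, and let $(m_{s,t})_{s,t\in[d]}$ be a tuple of non-negative integers. Let $\mathcal T_\rho(\mathbf n)$ be the set of rooted trees (acyclic connected graphs with a distinguished root vertex) with vertex set $\{(t,i): t\in[d],\ 1\le i\le n_t\}$ whose root vertex is of the form $(\rho,i)$ for some $i$. The vertex $(t,i)$ has type $t$. The edges of a rooted tree are oriented toward its root (from child to parent), and an edge has type $(s,t)$ if it goes from a vertex of type $s$ to a vertex of type $t$. A tree in $\mathcal T_\rho(\mathbf n)$ is injective if every vertex has at most one child of each type. Let $\mathrm{Cay}_d^\rho$ be the set of trees with vertex set $[d]$, rooted at the vertex $\rho$ and oriented toward it; $(s,t)\in A$ means that $(s,t)$ is an oriented edge of $A$. Then the number of injective trees in $\mathcal T_\rho(\mathbf n)$ with exactly $m_{s,t}$ edges of type $(s,t)$ for all $s,t\in[d]$ is $$\prod_{s,t\in[d]}\binom{n_t}{m_{s,t}}\ \prod_{s\in[d]}(n_s-1)!\ \times\sum_{A\in\mathrm{Cay}_d^\rho}\ \prod_{(s,t)\in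 A}m_{s,t}$$ if $n_s=\delta_{s,\rho}+\sum_{t\in[d]}m_{s,t}$ for all $s\in[d]$ (where $\delta_{s,\rho}$ is the Kronecker delta), and it is $0$ otherwise. -/

import Mathlib

open Finset

namespace MultitypeCayley

/-- A rooted (labelled) tree on the vertex set `V`: an acyclic connected graph together with
a distinguished root vertex. -/
@[ext]
structure RootedTree (V : Type*) where
  graph : SimpleGraph V
  isTree : graph.IsTree
  root : V

namespace RootedTree

variable {V : Type*}

/-- Orientation of the edges toward the root: `T.Arc u v` means that `{u, v}` is an edge of `T`,
oriented from `u` to `v`, i.e. `v` is the parent of `u` (it is one step closer to the root). -/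
def Arc (T : RootedTree V) (u v : V) : Prop :=
  T.graph.Adj u v ∧ T.graph.dist u T.root = T.graph.dist v T.root + 1

instance [Finite V] : Finite (RootedTree V) :=
  Finite.of_injective (fun T : RootedTree V => (T.graph, T.root)) (by
    intro S T h
    simp only [Prod.mk.injEq] at h
    exact RootedTree.ext h.1 h.2)

noncomputable instance [Finite V] : Fintype (RootedTree V) := Fintype.ofFinite _

open scoped Classical in
/-- The set of oriented edges `(u, v)` of a rooted tree. -/
noncomputable def arcs [Fintype V] (T : RootedTree V) : Finset (V × V) :=
  {e : V × V | T.Arc e.1 e.2}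

end RootedTree

/-- The vertex set `{(t, i) : t ∈ [d], i ∈ [n_t]}`; the vertex `⟨t, i⟩` has type `t` and
label `i`. -/
abbrev Vertex {d : ℕ} (n : Fin d → ℕ) : Type := Σ t : Fin d, Fin (n t)

open scoped Classical in
/-- The number of children of type `s` of the vertex `v`. -/
noncomputable def childCount {d : ℕ} {n : Fin d → ℕ} (T : RootedTree (Vertex n))
    (s : Fin d) (v : Vertex n) : ℕ :=
  #{u : Vertex n | T.Arc u v ∧ u.1 = s}

open scoped Classical in
/-- The number of edges of type `(s, t)`, that is, oriented edges going from a vertex of type `s`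
to a vertex (its parent) of type `t`. -/
noncomputable def edgeCount {d : ℕ} {n : Fin d → ℕ} (T : RootedTree (Vertex n))
    (s t : Fin d) : ℕ :=
  #{e ∈ T.arcs | e.1.1 = s ∧ e.2.1 = t}

/-- Every vertex has at most one child of each type. -/
def IsInjective {d : ℕ} {n : Fin d → ℕ} (T : RootedTree (Vertex n)) : Prop :=
  ∀ (v : Vertex n) (s : Fin d), childCount T s v ≤ 1

open scoped Classical in
/-- The rooted multitype Cayley trees of profile `n` whose root vertex has type `ρ`. -/
noncomputable def multitypeTrees {d : ℕ} (n : Fin d → ℕ) (ρ : Fin d) :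
    Finset (RootedTree (Vertex n)) :=
  {T | T.root.1 = ρ}

open scoped Classical in
/-- The trees of `multitypeTrees n ρ` that are injective and have `m s t` edges of type `(s, t)`
for all `s`, `t`. -/
noncomputable def injectiveTrees {d : ℕ} (n : Fin d → ℕ) (ρ : Fin d) (m : Fin d → Fin d → ℕ) :
    Finset (RootedTree (Vertex n)) :=
  {T ∈ multitypeTrees n ρ | IsInjective T ∧ ∀ s t, edgeCount T s t = m s t}

open scoped Classical in
/-- The (unitype) Cayley trees with vertex set `[d]` rooted at the vertex `ρ`. -/
noncomputable def cayleyTrees (d : ℕ) (ρ : Fin d) : Finset (RootedTree (Fin d)) :=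
  {A | A.root = ρ}

/-- The compatibility condition `n_s = δ_{s,ρ} + ∑_t m_{s,t}` for all `s`. -/
def Compatible {d : ℕ} (n : Fin d → ℕ) (ρ : Fin d) (m : Fin d → Fin d → ℕ) : Prop :=
  ∀ s : Fin d, n s = (if s = ρ then 1 else 0) + ∑ t, m s t

end MultitypeCayley

/-! ### Acyclic partial maps. -/

namespace MultitypeCayley

/-! A tree is encoded by its parent map. Fix, for all `s` and `t`, the set `E s t` of labels of
type-`t` vertices having a type-`s` child; these choices give the binomials. Each such label is a
slot for a type-`s` child, and one ownerless slot of type `ρ` awaits the root. An injective tree is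
then a type-preserving bijection from vertices to slots whose owner map is acyclic
(`card_filter_injectiveTrees`); compatibility says that the counts agree type by type.

By `card_fillings`, the acyclic bijections number ∏ (n_s - 1)! times the acyclic selections of one
slot per type. The induction deletes a vertex owning no slot: it may take any slot of its type, and
both sides obey the same recursion. Finally, a selection induces a parent map on types, i.e. a
Cayley tree `A`, each of whose edges `(s, t)` is realised by `m s t` slots
(`card_selections_slots`). -/

/-- A partial self-map `p` is acyclic if it strictly decreases some rank function. -/
def AcyclicMap {V : Type*} (p : V → Option V) : Prop :=
  ∃ h : V → ℕ, ∀ u v, p u = some v → h v < h u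

theorem AcyclicMap.exists_not_mem {V : Type*} {p : V → Option V} (hp : AcyclicMap p)
    {U : Finset V} (hU : U.Nonempty) : ∃ u ∈ U, ∀ v ∈ U, p u ≠ some v := by
  obtain ⟨h, hh⟩ := hp
  obtain ⟨u, hu, hmin⟩ := U.exists_min_image h hU
  exact ⟨u, hu, fun v hv huv => absurd (hh u v huv) (not_lt.2 (hmin v hv))⟩

/-- An acyclic map stays acyclic when its value is changed at a point outside its range. -/
theorem AcyclicMap.of_eq_off {V : Type*} {p q : V → Option V} (hp : AcyclicMap p) (v : V)
    (hpq : ∀ u, u ≠ v → q u = p u) (hq : ∀ u, q u ≠ some v) : AcyclicMap q := by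
  classical
  obtain ⟨h, hh⟩ := hp
  -- Nothing maps to `v` under `q`, so its rank need only exceed that of `q v`; the default 0 covers
  -- `q v = none`.
  refine ⟨Function.update h v (((q v).map h).getD 0 + 1), fun u w huw => ?_⟩
  have hwv : w ≠ v := fun e => hq u (e ▸ huw)
  by_cases huv : u = v
  · subst huv
    simp [Function.update_of_ne hwv, huw]
  · rw [Function.update_of_ne hwv, Function.update_of_ne huv]
    exact hh u w (hpq u huv ▸ huw)

/-! ### Acyclic fillings and selections of slots. -/

section Fillings

variable {V τ X : Type*} [Fintype V] [Fintype X]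

open scoped Classical in
/-- The type-preserving injective assignments of a slot in `Y` to every vertex in `U`, for which
the map sending a vertex to the owner of its slot is acyclic. -/
noncomputable def fillings (tp : V → τ) (typ : X → τ) (own : X → Option V) (U : Finset V)
    (Y : Finset X) : Finset (V → Option X) :=
  {f | (∀ u ∉ U, f u = none) ∧ (∀ u ∈ U, ∃ x ∈ Y, f u = some x ∧ typ x = tp u) ∧
    (∀ u u' x, f u = some x → f u' = some x → u = u') ∧ AcyclicMap fun u => (f u).bind own}

variable {tp : V → τ} {typ : X → τ} {own : X → Option V} {U : Finset V} {Y : Finset X}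

theorem mem_fillings {f : V → Option X} : f ∈ fillings tp typ own U Y ↔
    (∀ u ∉ U, f u = none) ∧ (∀ u ∈ U, ∃ x ∈ Y, f u = some x ∧ typ x = tp u) ∧
    (∀ u u' x, f u = some x → f u' = some x → u = u') ∧
    AcyclicMap fun u => (f u).bind own := by
  simp [fillings]

open scoped Classical in
/-- Removing a vertex without slots and the slot assigned to it. -/
theorem card_filter_fillings_eq {v : V} (hv : v ∈ U) (hY : ∀ x ∈ Y, own x ≠ some v) {x : X}
    (hx : x ∈ Y) (hxv : typ x = tp v) :
    #{f ∈ fillings tp typ own U Y | f v = some x} =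
      #(fillings tp typ own (U.erase v) (Y.erase x)) := by
  refine card_nbij' (fun f => Function.update f v none) (fun f => Function.update f v (some x))
    ?_ ?_ ?_ ?_
  · intro f hf
    simp only [coe_filter, mem_fillings, Set.mem_ofPred_eq] at hf
    obtain ⟨⟨h1, h2, h3, h4⟩, h5⟩ := hf
    simp only [mem_coe, mem_fillings]
    refine ⟨fun u hu => ?_, fun u hu => ?_, fun u u' y hu hu' => ?_, ?_⟩
    · by_cases huv : u = v
      · simp [huv]
      · rw [Function.update_of_ne huv]
        exact h1 u fun h => hu (mem_erase.2 ⟨huv, h⟩)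
    · obtain ⟨huv, hu⟩ := mem_erase.1 hu
      obtain ⟨y, hy, hfy, hty⟩ := h2 u hu
      rw [Function.update_of_ne huv]
      exact ⟨y, mem_erase.2 ⟨fun h => huv (h3 u v x (h ▸ hfy) h5), hy⟩, hfy, hty⟩
    · have huv : u ≠ v := by rintro rfl; simp at hu
      have huv' : u' ≠ v := by rintro rfl; simp at hu'
      rw [Function.update_of_ne huv] at hu
      rw [Function.update_of_ne huv'] at hu'
      exact h3 u u' y hu hu'
    · obtain ⟨h, hh⟩ := h4
      refine ⟨h, fun u w huw => ?_⟩
      have huv : u ≠ v := by rintro rfl; simp at huw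
      simp only [Function.update_of_ne huv] at huw
      exact hh u w huw
  · intro f hf
    simp only [mem_coe, mem_fillings] at hf
    obtain ⟨h1, h2, h3, h4⟩ := hf
    have hmem : ∀ u y, f u = some y → y ∈ Y.erase x := by
      intro u y hy
      by_cases hu : u ∈ U.erase v
      · obtain ⟨z, hz, hfz, -⟩ := h2 u hu
        rw [hy, Option.some_inj] at hfz
        exact hfz ▸ hz
      · simp [h1 u hu] at hy
    have hmem' : ∀ u y, Function.update f v (some x) u = some y → y ∈ Y := by
      intro u y hy
      by_cases huv : u = v
      · subst huv
        rw [Function.update_self, Option.some_inj] at hy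
        exact hy ▸ hx
      · rw [Function.update_of_ne huv] at hy
        exact mem_of_mem_erase (hmem u y hy)
    simp only [coe_filter, mem_fillings, Set.mem_ofPred_eq, Function.update_self, and_true]
    refine ⟨fun u hu => ?_, fun u hu => ?_, fun u u' y hu hu' => ?_, ?_⟩
    · have huv : u ≠ v := by rintro rfl; exact hu hv
      rw [Function.update_of_ne huv]
      exact h1 u fun h => hu (mem_of_mem_erase h)
    · by_cases huv : u = v
      · subst huv
        exact ⟨x, hx, by simp, hxv⟩
      · obtain ⟨y, hy, hfy⟩ := h2 u (mem_erase.2 ⟨huv, hu⟩)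
        rw [Function.update_of_ne huv]
        exact ⟨y, mem_of_mem_erase hy, hfy⟩
    · by_cases huv : u = v <;> by_cases huv' : u' = v
      · rw [huv, huv']
      · subst huv
        rw [Function.update_self, Option.some_inj] at hu
        rw [Function.update_of_ne huv'] at hu'
        exact absurd hu.symm (ne_of_mem_erase (hmem _ _ hu'))
      · subst huv'
        rw [Function.update_self, Option.some_inj] at hu'
        rw [Function.update_of_ne huv] at hu
        exact absurd hu'.symm (ne_of_mem_erase (hmem _ _ hu))
      · rw [Function.update_of_ne huv] at hu
        rw [Function.update_of_ne huv'] at hu'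
        exact h3 u u' y hu hu'
    · refine h4.of_eq_off v (fun u huv => by simp only [Function.update_of_ne huv]) fun u hu => ?_
      obtain ⟨y, hy, hyv⟩ := Option.bind_eq_some_iff.1 hu
      exact hY y (hmem' u y hy) hyv
  · intro f hf
    simp only [coe_filter, Set.mem_ofPred_eq] at hf
    simp [← hf.2]
  · intro f hf
    simp only [mem_coe, mem_fillings] at hf
    simp [← hf.1 v (by simp)]

-- A vertex owning no slot cannot lie on a cycle, so its own slot is a free choice. This applies to
-- vertices and, through `selections`, to types.
open scoped Classical in
theorem card_fillings_eq_sum [DecidableEq τ] {v : V} (hv : v ∈ U) (hY : ∀ x ∈ Y, own x ≠ some v) :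
    #(fillings tp typ own U Y) =
      ∑ x ∈ Y with typ x = tp v, #(fillings tp typ own (U.erase v) (Y.erase x)) := by
  have hmaps : ∀ f ∈ fillings tp typ own U Y,
      f v ∈ ({x ∈ Y | typ x = tp v}).map Function.Embedding.some := by
    intro f hf
    obtain ⟨x, hx, hfx, hxv⟩ := (mem_fillings.1 hf).2.1 v hv
    simp [hfx, hx, hxv]
  rw [card_eq_sum_card_fiberwise hmaps, sum_map]
  refine sum_congr rfl fun x hx => ?_
  obtain ⟨hx, hxv⟩ := mem_filter.1 hx
  exact card_filter_fillings_eq hv hY hx hxv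

/-- If all owners of slots are to be filled themselves, there is no acyclic filling. -/
theorem fillings_eq_empty (hU : U.Nonempty) (hY : ∀ x ∈ Y, ∃ u ∈ U, own x = some u) :
    fillings tp typ own U Y = ∅ := by
  refine eq_empty_of_forall_notMem fun f hf => ?_
  obtain ⟨-, h2, -, h4⟩ := mem_fillings.1 hf
  obtain ⟨u, hu, hne⟩ := h4.exists_not_mem hU
  obtain ⟨x, hx, hfx, -⟩ := h2 u hu
  obtain ⟨w, hw, hxw⟩ := hY x hx
  exact hne w hw (by simp [hfx, hxw])

/-- The choices of one slot in `Y` for every type in `S`, such that the map sending a type to the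
type of the owner of its slot is acyclic. -/
noncomputable abbrev selections {V : Type*} [Fintype τ] (tp : V → τ) (typ : X → τ) (own : X → Option V) (S : Finset τ)
    (Y : Finset X) : Finset (τ → Option X) :=
  fillings id typ (fun x => (own x).map tp) S Y

open scoped Classical in
theorem selections_erase {V : Type*} [Fintype τ] {tp : V → τ} {own : X → Option V} {S : Finset τ} {s : τ} {x : X} (hs : s ∈ S) (hx : typ x = s) :
    selections tp typ own S (Y.erase x) =
      {g ∈ selections tp typ own S Y | g s ≠ some x} := by
  ext g
  simp only [mem_filter, mem_fillings]
  constructor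
  · rintro ⟨h1, h2, h3, h4⟩
    refine ⟨⟨h1, fun u hu => ?_, h3, h4⟩, fun hg => ?_⟩
    · obtain ⟨y, hy, h⟩ := h2 u hu
      exact ⟨y, mem_of_mem_erase hy, h⟩
    · obtain ⟨y, hy, hgy, -⟩ := h2 s hs
      rw [hg, Option.some_inj] at hgy
      exact ne_of_mem_erase hy hgy.symm
  · rintro ⟨⟨h1, h2, h3, h4⟩, hg⟩
    refine ⟨h1, fun u hu => ?_, h3, h4⟩
    obtain ⟨y, hy, hgy, hyu⟩ := h2 u hu
    refine ⟨y, mem_erase.2 ⟨?_, hy⟩, hgy, hyu⟩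
    rintro rfl
    obtain rfl : s = u := hx.symm.trans hyu
    exact hg hgy

-- Double counting: a selection uses exactly one slot of type `s`, so it survives the erasure of
-- each of the others.
open scoped Classical in
theorem sum_card_selections_erase {V : Type*} [Fintype τ] [DecidableEq τ] {tp : V → τ} 
    {own : X → Option V} {S : Finset τ} {s : τ} (hs : s ∈ S) :
    ∑ x ∈ Y with typ x = s, #(selections tp typ own S (Y.erase x)) =
      (#{x ∈ Y | typ x = s} - 1) * #(selections tp typ own S Y) := by
  have h : ∀ x ∈ ({x ∈ Y | typ x = s} : Finset X), #(selections tp typ own S (Y.erase x)) =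
      ∑ g ∈ selections tp typ own S Y, if g s ≠ some x then 1 else 0 := by
    intro x hx
    rw [selections_erase hs (mem_filter.1 hx).2, card_filter]
  rw [sum_congr rfl h, sum_comm, mul_comm, ← smul_eq_mul, ← sum_const]
  refine sum_congr rfl fun g hg => ?_
  obtain ⟨x, hx, hgx, hxs⟩ := (mem_fillings.1 hg).2.1 s hs
  rw [← card_filter, ← card_erase_of_mem (mem_filter.2 ⟨hx, hxs⟩)]
  congr 1
  ext y
  simp only [mem_filter, mem_erase, hgx, ne_eq, Option.some_inj]
  tauto

theorem fillings_empty : fillings tp typ own ∅ Y = {fun _ => none} := by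
  ext f
  rw [mem_fillings, mem_singleton]
  constructor
  · rintro ⟨h, -⟩
    exact funext fun u => h u (notMem_empty u)
  · rintro rfl
    exact ⟨by simp, by simp, by simp, 0, by simp⟩

open scoped Classical in
/-- The number of acyclic fillings is a multiple of the number of acyclic selections. -/
theorem card_fillings [Fintype τ] [DecidableEq τ]
    (h : ∀ s, #{u ∈ U | tp u = s} = #{x ∈ Y | typ x = s})
    (hown : ∀ x ∈ Y, ∀ u, own x = some u → u ∈ U) :
    #(fillings tp typ own U Y) =
      (∏ s ∈ U.image tp, (#{u ∈ U | tp u = s} - 1).factorial) *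
        #(selections tp typ own (U.image tp) Y) := by
  induction hk : #U generalizing U Y with
  | zero =>
    obtain rfl := card_eq_zero.1 hk
    simp [fillings_empty]
  | succ k ih =>
    have hU : U.Nonempty := card_pos.1 (by omega)
    by_cases hleaf : ∃ v ∈ U, ∀ x ∈ Y, own x ≠ some v
    · obtain ⟨v, hv, hvY⟩ := hleaf
      have hcard : ∀ r, #{u ∈ U.erase v | tp u = r} =
          if r = tp v then #{u ∈ U | tp u = r} - 1 else #{u ∈ U | tp u = r} := by
        intro r
        rw [filter_erase, card_erase_eq_ite]
        simp [hv, eq_comm]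
      have hstep : ∀ x ∈ ({x ∈ Y | typ x = tp v} : Finset X),
          #(fillings tp typ own (U.erase v) (Y.erase x)) =
            (∏ s ∈ (U.erase v).image tp, (#{u ∈ U.erase v | tp u = s} - 1).factorial) *
              #(selections tp typ own ((U.erase v).image tp) (Y.erase x)) := by
        intro x hx
        obtain ⟨hx, hxv⟩ := mem_filter.1 hx
        refine ih (fun r => ?_) (fun y hy u hyu => ?_) (by rw [card_erase_of_mem hv, hk]; rfl)
        · rw [hcard, h, filter_erase, card_erase_eq_ite]
          simp [hx, hxv, eq_comm]
        · have hy := mem_of_mem_erase hy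
          exact mem_erase.2 ⟨fun e => hvY y hy (e ▸ hyu), hown y hy u hyu⟩
      have hs : tp v ∈ U.image tp := mem_image_of_mem tp hv
      have hpos : 0 < #{u ∈ U | tp u = tp v} := card_pos.2 ⟨v, by simp [hv]⟩
      have hprod : ∏ r ∈ (U.image tp).erase (tp v), (#{u ∈ U.erase v | tp u = r} - 1).factorial =
          ∏ r ∈ (U.image tp).erase (tp v), (#{u ∈ U | tp u = r} - 1).factorial :=
        prod_congr rfl fun r hr => by rw [hcard, if_neg (ne_of_mem_erase hr)]
      rw [card_fillings_eq_sum hv hvY, sum_congr rfl hstep, ← mul_sum, ← mul_prod_erase _ _ hs]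
      -- If `v` is the last vertex of its type, that type owns no slot either, and the selections
      -- satisfy the same leaf recursion as the fillings.
      by_cases hone : #{u ∈ U | tp u = tp v} = 1
      · have huniq : ∀ u ∈ U, tp u = tp v → u = v := fun u hu huv =>
          card_le_one.1 hone.le u (by simp [hu, huv]) v (by simp [hv])
        have himg : (U.erase v).image tp = (U.image tp).erase (tp v) := by
          ext r
          simp only [mem_image, mem_erase]
          constructor
          · rintro ⟨u, ⟨huv, hu⟩, rfl⟩
            exact ⟨fun e => huv (huniq u hu e), u, hu, rfl⟩
          · rintro ⟨hr, u, hu, rfl⟩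
            exact ⟨u, ⟨fun e => hr (e ▸ rfl), hu⟩, rfl⟩
        have hown' : ∀ x ∈ Y, (own x).map tp ≠ some (tp v) := by
          intro x hx hxv
          obtain ⟨u, hxu, huv⟩ := Option.map_eq_some_iff.1 hxv
          exact hvY x hx (huniq u (hown x hx u hxu) huv ▸ hxu)
        rw [himg, hprod, hone, card_fillings_eq_sum hs hown']
        simp only [tsub_self, Nat.factorial_zero, one_mul]
        congr!
      -- Otherwise the set of types is unchanged, and double counting supplies the factor that turns
      -- `(c - 2)!` into `(c - 1)!`, with `c` the number of vertices of this type.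
      · have himg : (U.erase v).image tp = U.image tp := by
          refine (image_subset_image (erase_subset v U)).antisymm fun r hr => ?_
          obtain ⟨u, hu, rfl⟩ := mem_image.1 hr
          by_cases huv : u = v
          · obtain ⟨w, hw, hwv⟩ := exists_mem_ne (by omega : 1 < #{u ∈ U | tp u = tp v}) v
            rw [mem_filter] at hw
            exact mem_image.2 ⟨w, mem_erase.2 ⟨hwv, hw.1⟩, huv ▸ hw.2⟩
          · exact mem_image_of_mem tp (mem_erase.2 ⟨huv, hu⟩)
        rw [himg, ← mul_prod_erase _ _ hs, hprod, sum_card_selections_erase hs, hcard, if_pos rfl,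
          ← h]
        obtain ⟨j, hj⟩ : ∃ j, #{u ∈ U | tp u = tp v} = j + 2 :=
          Nat.exists_eq_add_of_le' (by omega)
        rw [hj, show j + 2 - 1 = j + 1 by omega, show j + 1 - 1 = j by omega,
          Nat.factorial_succ]
        ring
    -- Every vertex owns a slot and there are as many slots as vertices, so no slot is ownerless.
    -- Every filling or selection then has a cycle, and both sides vanish.
    · push Not at hleaf
      have hUY : #Y = #U := by
        rw [card_eq_sum_card_fiberwise (f := tp) (t := univ) (by simp),
          card_eq_sum_card_fiberwise (s := Y) (f := typ) (t := univ) (by simp)]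
        exact sum_congr rfl fun s _ => (h s).symm
      have himg : U.map Function.Embedding.some = Y.image own := by
        refine eq_of_subset_of_card_le (fun o ho => ?_) ?_
        · obtain ⟨u, hu, rfl⟩ := mem_map.1 ho
          obtain ⟨x, hx, hxu⟩ := hleaf u hu
          exact mem_image.2 ⟨x, hx, hxu⟩
        · rw [card_map, ← hUY]
          exact card_image_le
      have hY : ∀ x ∈ Y, ∃ u ∈ U, own x = some u := by
        intro x hx
        obtain ⟨u, hu, hux⟩ := mem_map.1 (himg ▸ mem_image_of_mem own hx)
        exact ⟨u, hu, hux.symm⟩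
      have hY' : ∀ x ∈ Y, ∃ s ∈ U.image tp, (own x).map tp = some s := by
        intro x hx
        obtain ⟨u, hu, hux⟩ := hY x hx
        exact ⟨tp u, mem_image_of_mem tp hu, by simp [hux]⟩
      rw [fillings_eq_empty hU hY, selections, fillings_eq_empty (hU.image tp) hY']
      simp

end Fillings
end MultitypeCayley

/-! ### Rooted trees as acyclic parent maps. -/

namespace MultitypeCayley
namespace RootedTree

variable {V : Type*} {T : RootedTree V}

/-- A parent is the second vertex of a shortest path to the root, and paths in a tree are unique. -/
theorem Arc.eq {u v w : V} (hv : T.Arc u v) (hw : T.Arc u w) : v = w := by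
  classical
  have key : ∀ {v : V}, T.Arc u v → ∃ p : T.graph.Walk u T.root, p.IsPath ∧ p.snd = v := by
    intro v hv
    obtain ⟨q, -, hq⟩ := T.isTree.connected.exists_path_of_dist v T.root
    refine ⟨.cons hv.1 q, SimpleGraph.Walk.isPath_of_length_eq_dist _ ?_, by simp⟩
    rw [SimpleGraph.Walk.length_cons, hq, hv.2]
  obtain ⟨p, hp, rfl⟩ := key hv
  obtain ⟨q, hq, rfl⟩ := key hw
  rw [(T.isTree.existsUnique_path _ _).unique hp hq]

theorem exists_arc {u : V} (hu : u ≠ T.root) : ∃ v, T.Arc u v := by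
  obtain ⟨p, -, hp⟩ := T.isTree.connected.exists_path_of_dist u T.root
  cases p with
  | nil => exact absurd rfl hu
  | @cons _ v _ h q =>
    refine ⟨v, h, ?_⟩
    rw [SimpleGraph.Walk.length_cons] at hp
    have h1 := SimpleGraph.dist_le q
    have h2 := h.diff_dist_adj (u := T.root)
    rw [SimpleGraph.dist_comm (u := T.root), SimpleGraph.dist_comm (u := T.root)] at h2
    omega

theorem not_arc_root (v : V) : ¬ T.Arc T.root v := fun h => by simpa using h.2

theorem adj_iff {u v : V} : T.graph.Adj u v ↔ T.Arc u v ∨ T.Arc v u := by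
  refine ⟨fun h => ?_, fun h => h.elim (·.1) (·.1.symm)⟩
  have h2 := T.isTree.dist_eq_dist_add_one_of_adj T.root h
  rw [SimpleGraph.dist_comm (u := T.root), SimpleGraph.dist_comm (u := T.root)] at h2
  exact h2.imp (⟨h, ·⟩) (⟨h.symm, ·⟩)

open scoped Classical in
/-- The parent of a vertex, if it is not the root. -/
noncomputable def parent (T : RootedTree V) (u : V) : Option V :=
  if h : ∃ v, T.Arc u v then some h.choose else none

theorem parent_eq_some {u v : V} : T.parent u = some v ↔ T.Arc u v := by
  unfold parent
  split_ifs with h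
  · rw [Option.some_inj]
    exact ⟨fun e => e ▸ h.choose_spec, fun hv => h.choose_spec.eq hv⟩
  · simpa using fun hv => h ⟨v, hv⟩

theorem parent_eq_none {u : V} : T.parent u = none ↔ u = T.root := by
  rw [Option.eq_none_iff_forall_ne_some]
  constructor
  · intro h
    by_contra hu
    obtain ⟨v, hv⟩ := exists_arc hu
    exact h v (parent_eq_some.2 hv)
  · rintro rfl v hv
    exact not_arc_root v (parent_eq_some.1 hv)

theorem acyclicMap_parent (T : RootedTree V) : AcyclicMap T.parent :=
  ⟨fun u => T.graph.dist u T.root, fun u v h => by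
    rw [parent_eq_some] at h
    exact Nat.lt_of_lt_of_eq (Nat.lt_succ_self _) h.2.symm⟩

theorem parent_injective : Function.Injective (parent : RootedTree V → V → Option V) := by
  intro S T h
  have harc : ∀ u v, S.Arc u v ↔ T.Arc u v := fun u v => by
    rw [← parent_eq_some, ← parent_eq_some, h]
  refine RootedTree.ext ?_ ?_
  · ext u v
    rw [adj_iff, adj_iff, harc, harc]
  · rw [← parent_eq_none, ← h, parent_eq_none]

end RootedTree

/-- The graph whose edges join every vertex to its image under a partial self-map. -/
def parentGraph {V : Type*} (p : V → Option V) : SimpleGraph V :=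
  SimpleGraph.fromRel fun u v => p u = some v

section ParentGraph

variable {V : Type*} {p : V → Option V} {r : V}

theorem AcyclicMap.ne (hp : AcyclicMap p) {u v : V} (h : p u = some v) : u ≠ v := by
  rintro rfl
  obtain ⟨h', hh⟩ := hp
  exact lt_irrefl _ (hh u u h)

theorem AcyclicMap.adj_iff (hp : AcyclicMap p) {u v : V} :
    (parentGraph p).Adj u v ↔ p u = some v ∨ p v = some u := by
  rw [parentGraph, SimpleGraph.fromRel_adj]
  exact ⟨And.right, fun h => ⟨h.elim hp.ne fun h => (hp.ne h).symm, h⟩⟩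

theorem AcyclicMap.induction (hp : AcyclicMap p) (hr : ∀ u, p u = none ↔ u = r) {P : V → Prop}
    (root : P r) (step : ∀ u v, p u = some v → P v → P u) (u : V) : P u := by
  obtain ⟨h, hh⟩ := hp
  induction hk : h u using Nat.strong_induction_on generalizing u with
  | _ k ih =>
    cases hu : p u with
    | none => exact (hr u).1 hu ▸ root
    | some v => exact step u v hu (ih _ (hk ▸ hh u v hu) v rfl)

theorem AcyclicMap.connected (hp : AcyclicMap p) (hr : ∀ u, p u = none ↔ u = r) :
    (parentGraph p).Connected := by
  have h : ∀ u, (parentGraph p).Reachable u r :=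
    hp.induction hr .rfl fun u v huv hv => (hp.adj_iff.2 (.inl huv)).reachable.trans hv
  exact (SimpleGraph.connected_iff_exists_forall_reachable _).2 ⟨r, fun u => (h u).symm⟩

/-- A connected graph with at most `|V| - 1` edges is a tree, and every edge here is `{u, p u}` with
`u ≠ r`. -/
theorem AcyclicMap.isTree [Finite V] (hp : AcyclicMap p) (hr : ∀ u, p u = none ↔ u = r) :
    (parentGraph p).IsTree := by
  classical
  have := Fintype.ofFinite V
  have hc := hp.connected hr
  refine SimpleGraph.isTree_iff_connected_and_card.2
    ⟨hc, le_antisymm ?_ hc.card_vert_le_card_edgeSet_add_one⟩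
  have hsub : (parentGraph p).edgeSet ⊆
      ((univ.erase r).image fun u => s(u, (p u).getD u) : Finset (Sym2 V)) := by
    intro e
    induction e with | _ u v => ?_
    rw [SimpleGraph.mem_edgeSet, hp.adj_iff, mem_coe, mem_image]
    have key : ∀ u v, p u = some v → u ∈ univ.erase r := fun u v h =>
      mem_erase.2 ⟨fun e => by simp [(hr u).2 e] at h, mem_univ _⟩
    rintro (h | h)
    · exact ⟨u, key _ _ h, by simp [h]⟩
    · exact ⟨v, key _ _ h, by simp [h, Sym2.eq_swap]⟩
  have h1 := Set.ncard_le_ncard hsub (Finset.finite_toSet _)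
  rw [Set.ncard_coe_finset] at h1
  have h2 := h1.trans card_image_le
  rw [card_erase_of_mem (mem_univ r), card_univ] at h2
  have h3 : 0 < Fintype.card V := Fintype.card_pos_iff.2 ⟨r⟩
  rw [Nat.card_coe_set_eq, Nat.card_eq_fintype_card]
  omega

/-- An acyclic map which is defined outside `r` is the parent map of a tree with root `r`. -/
theorem AcyclicMap.exists_rootedTree [Finite V] (hp : AcyclicMap p)
    (hr : ∀ u, p u = none ↔ u = r) : ∃ T : RootedTree V, T.parent = p ∧ T.root = r := by
  let T : RootedTree V := ⟨parentGraph p, hp.isTree hr, r⟩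
  have harc : ∀ u, ∀ v, p u = some v → T.Arc u v := by
    refine hp.induction hr (fun v hv => ?_) fun u v huv ih w hw => ?_
    · simp [(hr r).2 rfl] at hv
    · obtain rfl : v = w := Option.some_inj.1 (huv ▸ hw)
      -- If the edge pointed from `v` to `u`, then `v` would not be the root and, by induction, `p v
      -- = u`, a 2-cycle with `p u = v`.
      refine (RootedTree.adj_iff.1 (hp.adj_iff.2 (.inl huv))).resolve_right fun hvu => ?_
      cases hv : p v with
      | none =>
        obtain rfl := (hr v).1 hv
        exact RootedTree.not_arc_root (T := T) u hvu
      | some w =>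
        obtain rfl := (ih w hv).eq hvu
        obtain ⟨h, hh⟩ := hp
        exact lt_asymm (hh _ _ hv) (hh _ _ huv)
  refine ⟨T, funext fun u => ?_, rfl⟩
  cases hu : p u with
  | none => exact RootedTree.parent_eq_none.2 ((hr u).1 hu)
  | some v => exact RootedTree.parent_eq_some.2 (harc u v hu)

end ParentGraph

end MultitypeCayley

namespace MultitypeCayley

theorem RootedTree.prod_arcs {V M : Type*} [Fintype V] [CommMonoid M] (T : RootedTree V)
    (m : V → V → M) : ∏ e ∈ T.arcs, m e.1 e.2 = ∏ u, (T.parent u).elim 1 (m u) := by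
  classical
  rw [arcs, prod_filter, Fintype.prod_prod_type]
  refine prod_congr rfl fun u _ => ?_
  cases hu : T.parent u with
  | none => exact prod_eq_one fun v _ => if_neg fun h => by simp [parent_eq_some.2 h] at hu
  | some v =>
    rw [prod_eq_single v (fun w _ hw => if_neg fun h => hw ?_) (by simp),
      if_pos (parent_eq_some.1 hu), Option.elim_some]
    exact h.eq (parent_eq_some.1 hu)

/-! ### Slots, and selections as Cayley trees. -/

section Slots

variable {d : ℕ} {n : Fin d → ℕ} {ρ : Fin d} {E : Fin d → (t : Fin d) → Finset (Fin (n t))}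

open scoped Classical in
/-- The slots `(s, some v)`, for a child of type `s` of the vertex `v`, given by the sets `E s t`
of the labels of the vertices of type `t` with a child of type `s`, together with the slot
`(ρ, none)` of the root. -/
noncomputable def slots (ρ : Fin d) (E : Fin d → (t : Fin d) → Finset (Fin (n t))) :
    Finset (Fin d × Option (Vertex n)) :=
  {x | x.2.elim (x.1 = ρ) fun v => v.2 ∈ E x.1 v.1}

@[simp]
theorem mk_none_mem_slots {s : Fin d} : (s, none) ∈ slots ρ E ↔ s = ρ := by simp [slots]

@[simp]
theorem mk_some_mem_slots {s : Fin d} {v : Vertex n} :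
    (s, some v) ∈ slots ρ E ↔ v.2 ∈ E s v.1 := by simp [slots]

theorem card_filter_slots (s : Fin d) (Q : Option (Fin d) → Prop) [DecidablePred Q] :
    #{x ∈ slots ρ E | x.1 = s ∧ Q (x.2.map Sigma.fst)} =
      (if s = ρ ∧ Q none then 1 else 0) + ∑ t, if Q (some t) then #(E s t) else 0 := by
  have h : ({x ∈ slots ρ E | x.1 = s ∧ Q (x.2.map Sigma.fst)} : Finset _) =
      ({o | (s, o) ∈ slots ρ E ∧ Q (o.map Sigma.fst)} : Finset (Option (Vertex n))).map
        ⟨Prod.mk s, Prod.mk_right_injective s⟩ := by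
    ext ⟨s', o⟩
    simp only [mem_filter, mem_map, mem_univ, true_and, Function.Embedding.coeFn_mk,
      Prod.mk.injEq, exists_eq_right_right]
    constructor
    · rintro ⟨h1, rfl, h2⟩
      exact ⟨⟨h1, h2⟩, rfl⟩
    · rintro ⟨⟨h1, h2⟩, rfl⟩
      exact ⟨h1, rfl, h2⟩
  rw [h, card_map, card_filter, Fintype.sum_option, Fintype.sum_sigma]
  simp only [mk_none_mem_slots, mk_some_mem_slots, Option.map_none, Option.map_some]
  congr 1
  refine sum_congr rfl fun t _ => ?_
  by_cases hQ : Q (some t) <;> simp [hQ]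

theorem card_filter_slots_fst (s : Fin d) :
    #{x ∈ slots ρ E | x.1 = s} = (if s = ρ then 1 else 0) + ∑ t, #(E s t) := by
  simpa using card_filter_slots (ρ := ρ) (E := E) s fun _ => True

theorem card_filter_slots_some (s t : Fin d) :
    #{x ∈ slots ρ E | x.1 = s ∧ x.2.map Sigma.fst = some t} = #(E s t) := by
  simpa using card_filter_slots (ρ := ρ) (E := E) s fun o => o = some t

theorem card_filter_slots_none :
    #{x ∈ slots ρ E | x.1 = ρ ∧ x.2.map Sigma.fst = none} = 1 := by
  simpa using card_filter_slots (ρ := ρ) (E := E) ρ fun o => o = none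

/-- The acyclic selections of slots are counted by Cayley trees. -/
theorem card_selections_slots :
    #(selections (Sigma.fst : Vertex n → Fin d) Prod.fst Prod.snd univ (slots ρ E)) =
      ∑ A ∈ cayleyTrees d ρ, ∏ e ∈ A.arcs, #(E e.1 e.2) := by
  classical
  have hmaps : ∀ g ∈ selections (Sigma.fst : Vertex n → Fin d) Prod.fst Prod.snd univ (slots ρ E),
      (fun s => (g s).bind fun x => x.2.map Sigma.fst) ∈
        (cayleyTrees d ρ).image RootedTree.parent := by
    intro g hg
    obtain ⟨-, h2, -, h4⟩ := mem_fillings.1 hg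
    have hρ : ∀ s, ((g s).bind fun x => x.2.map Sigma.fst) = none → s = ρ := by
      intro s hs
      obtain ⟨⟨s', o⟩, hx, hgx, rfl⟩ := h2 s (mem_univ s)
      cases o with
      | none => exact mk_none_mem_slots.1 hx
      | some v => simp [hgx] at hs
    -- An acyclic map on a finite nonempty set is undefined somewhere; by `hρ` this can only be at
    -- `ρ`.
    have hnone : ∀ s, ((g s).bind fun x => x.2.map Sigma.fst) = none ↔ s = ρ := by
      refine fun s => ⟨hρ s, ?_⟩
      rintro rfl
      obtain ⟨r, -, hr⟩ := h4.exists_not_mem (U := univ) ⟨s, mem_univ s⟩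
      have hr := Option.eq_none_iff_forall_ne_some.2 fun t => hr t (mem_univ t)
      rwa [hρ r hr] at hr
    obtain ⟨A, hA, hroot⟩ := h4.exists_rootedTree hnone
    exact mem_image.2 ⟨A, by simp [cayleyTrees, hroot], hA⟩
  rw [card_eq_sum_card_fiberwise hmaps, sum_image fun _ _ _ _ h => RootedTree.parent_injective h]
  refine sum_congr rfl fun A hA => ?_
  obtain rfl : A.root = ρ := by simpa [cayleyTrees] using hA
  -- The fibre over `A` is a product: each type independently picks a slot owned by its parent type
  -- in `A`, or the ownerless slot at the root.
  have hcard : ∀ s, #{x ∈ slots A.root E | x.1 = s ∧ x.2.map Sigma.fst = A.parent s} =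
      (A.parent s).elim 1 fun t => #(E s t) := by
    intro s
    cases hs : A.parent s with
    | none =>
      obtain rfl := RootedTree.parent_eq_none.1 hs
      exact card_filter_slots_none
    | some t => exact card_filter_slots_some s t
  rw [A.prod_arcs fun s t => #(E s t), ← prod_congr rfl fun s _ => hcard s,
    ← Fintype.card_piFinset]
  symm
  refine card_bij (fun g _ s => some (g s)) (fun g hg => ?_)
    (fun g _ g' _ h => funext fun s => Option.some_inj.1 (congrFun h s)) fun g hg => ?_
  · simp only [Fintype.mem_piFinset, mem_filter] at hg
    have hg' : (fun s => (g s).2.map Sigma.fst) = A.parent := funext fun s => (hg s).2.2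
    simp only [mem_filter, mem_fillings, Option.bind_some, hg', and_true]
    refine ⟨by simp, fun s _ => ⟨g s, (hg s).1, rfl, (hg s).2.1⟩, fun s s' x hs hs' => ?_,
      A.acyclicMap_parent⟩
    rw [← (hg s).2.1, ← (hg s').2.1, Option.some_inj.1 hs, Option.some_inj.1 hs']
  · obtain ⟨hg, hgA⟩ := mem_filter.1 hg
    obtain ⟨-, h2, -, -⟩ := mem_fillings.1 hg
    choose x hx hgx hxs using fun s => h2 s (mem_univ s)
    refine ⟨x, Fintype.mem_piFinset.2 fun s => mem_filter.2 ⟨hx s, hxs s, ?_⟩,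
      funext fun s => (hgx s).symm⟩
    simp [← hgA, hgx]

end Slots

/-! ### Injective trees as fillings. -/

section Trees

variable {d : ℕ} {n : Fin d → ℕ} {ρ : Fin d} {T : RootedTree (Vertex n)}
  {m : Fin d → Fin d → ℕ}

open scoped Classical in
/-- The labels of the vertices of type `t` with a child of type `s`. -/
noncomputable def parentLabels (T : RootedTree (Vertex n)) (s t : Fin d) : Finset (Fin (n t)) :=
  {j | ∃ u, T.parent u = some ⟨t, j⟩ ∧ u.1 = s}

theorem mem_parentLabels {s t : Fin d} {j : Fin (n t)} :
    j ∈ parentLabels T s t ↔ ∃ u, T.parent u = some ⟨t, j⟩ ∧ u.1 = s := by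
  simp [parentLabels]

theorem isInjective_iff : IsInjective T ↔
    ∀ u u' v, T.parent u = some v → T.parent u' = some v → u.1 = u'.1 → u = u' := by
  simp only [IsInjective, childCount, card_le_one, mem_filter, mem_univ, true_and,
    RootedTree.parent_eq_some]
  exact ⟨fun h u u' v hu hu' huu' => h v u.1 u ⟨hu, rfl⟩ u' ⟨hu', huu'.symm⟩,
    fun h v s u hu u' hu' => h u u' v hu.1 hu'.1 (hu.2.trans hu'.2.symm)⟩

/-- In an injective tree, an edge of type `(s, t)` is determined by its parent endpoint. -/
theorem IsInjective.edgeCount_eq (hT : IsInjective T) (s t : Fin d) :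
    edgeCount T s t = #(parentLabels T s t) := by
  classical
  rw [edgeCount, ← card_map (Function.Embedding.sigmaMk (β := fun t => Fin (n t)) t)]
  refine card_nbij Prod.snd ?_ ?_ ?_
  · rintro ⟨u, t', j⟩ h
    simp only [RootedTree.arcs, coe_filter, mem_filter, mem_univ, true_and,
      Set.mem_ofPred_eq] at h
    obtain ⟨harc, hs, rfl⟩ := h
    exact mem_map.2 ⟨j, mem_parentLabels.2 ⟨u, RootedTree.parent_eq_some.2 harc, hs⟩, rfl⟩
  · rintro ⟨u, v⟩ h ⟨u', v'⟩ h' (rfl : v = v')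
    simp only [RootedTree.arcs, coe_filter, mem_filter, mem_univ, true_and,
      Set.mem_ofPred_eq] at h h'
    rw [isInjective_iff.1 hT u u' v (RootedTree.parent_eq_some.2 h.1)
      (RootedTree.parent_eq_some.2 h'.1) (h.2.1.trans h'.2.1.symm)]
  · intro v hv
    obtain ⟨j, hj, rfl⟩ := mem_map.1 hv
    obtain ⟨u, hu, hs⟩ := mem_parentLabels.1 hj
    refine ⟨⟨u, _⟩, ?_, rfl⟩
    simpa [RootedTree.arcs, hs] using RootedTree.parent_eq_some.1 hu

theorem mem_injectiveTrees : T ∈ injectiveTrees n ρ m ↔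
    T.root.1 = ρ ∧ IsInjective T ∧ ∀ s t, #(parentLabels T s t) = m s t := by
  simp only [injectiveTrees, multitypeTrees, mem_filter, mem_univ, true_and]
  exact and_congr_right fun _ => and_congr_right fun h => by simp only [h.edgeCount_eq]

theorem IsInjective.slot_injective (hT : IsInjective T) :
    Function.Injective fun u : Vertex n => (u.1, T.parent u) := by
  intro u u' h
  obtain ⟨h1, h2⟩ := Prod.mk.inj h
  cases hu : T.parent u with
  | none => rw [RootedTree.parent_eq_none.1 hu, RootedTree.parent_eq_none.1 (h2.symm.trans hu)]
  | some v => exact isInjective_iff.1 hT u u' v hu (h2 ▸ hu) h1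

theorem slot_mem_slots (hρ : T.root.1 = ρ) (u : Vertex n) :
    (u.1, T.parent u) ∈ slots ρ (parentLabels T) := by
  cases hu : T.parent u with
  | none => rwa [mk_none_mem_slots, RootedTree.parent_eq_none.1 hu]
  | some v => exact mk_some_mem_slots.2 (mem_parentLabels.2 ⟨u, hu, rfl⟩)

theorem exists_slot_eq (hρ : T.root.1 = ρ) {x : Fin d × Option (Vertex n)}
    (hx : x ∈ slots ρ (parentLabels T)) : ∃ u : Vertex n, (u.1, T.parent u) = x := by
  obtain ⟨s, _ | v⟩ := x
  · rw [mk_none_mem_slots] at hx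
    exact ⟨T.root, by rw [hρ, hx, RootedTree.parent_eq_none.2 rfl]⟩
  · rw [mk_some_mem_slots] at hx
    obtain ⟨u, hu, hs⟩ := mem_parentLabels.1 hx
    exact ⟨u, by rw [hs, hu]⟩

theorem card_filter_fst_eq (s : Fin d) : #{u : Vertex n | u.1 = s} = n s := by
  rw [card_filter, Fintype.sum_sigma, sum_eq_single s (fun t _ ht => by simp [ht]) (by simp)]
  simp

/-- Sending a vertex to its type and parent matches the vertices of type `s` with the slots of type
`s`. -/
theorem compatible_of_mem_injectiveTrees (hT : T ∈ injectiveTrees n ρ m) : Compatible n ρ m := by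
  classical
  obtain ⟨hρ, hinj, hm⟩ := mem_injectiveTrees.1 hT
  intro s
  simp only [← hm]
  rw [← card_filter_slots_fst, ← card_filter_fst_eq (n := n) s]
  refine card_nbij (fun u => (u.1, T.parent u)) (fun u hu => ?_) hinj.slot_injective.injOn
    fun x hx => ?_
  · exact mem_filter.2 ⟨slot_mem_slots hρ u, (mem_filter.1 hu).2⟩
  · obtain ⟨hx, hxs⟩ := mem_filter.1 hx
    obtain ⟨u, rfl⟩ := exists_slot_eq hρ hx
    exact ⟨u, by simpa using hxs, rfl⟩

open scoped Classical in
/-- The injective trees with given sets of vertices which have a child of a given type. -/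
theorem card_filter_injectiveTrees (hc : Compatible n ρ m)
    {E : Fin d → (t : Fin d) → Finset (Fin (n t))} (hE : ∀ s t, #(E s t) = m s t) :
    #{T ∈ injectiveTrees n ρ m | parentLabels T = E} =
      #(fillings (Sigma.fst : Vertex n → Fin d) Prod.fst Prod.snd univ (slots ρ E)) := by
  refine card_bij (fun T _ u => some (u.1, T.parent u)) (fun T hT => ?_) (fun T _ T' _ h => ?_)
    fun f hf => ?_
  · have hT' : T ∈ injectiveTrees n ρ m := (mem_filter.1 hT).1
    obtain rfl : parentLabels T = E := (mem_filter.1 hT).2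
    obtain ⟨hρ, hinj, -⟩ := mem_injectiveTrees.1 hT'
    refine mem_fillings.2 ⟨fun u hu => absurd (mem_univ u) hu,
      fun u _ => ⟨(u.1, T.parent u), slot_mem_slots hρ u, rfl, rfl⟩, fun u u' x hu hu' => ?_,
      T.acyclicMap_parent⟩
    have h : (u.1, T.parent u) = (u'.1, T.parent u') := Option.some_inj.1 (hu.trans hu'.symm)
    exact hinj.slot_injective h
  · refine RootedTree.parent_injective (funext fun u => ?_)
    exact (Prod.mk.inj (Option.some_inj.1 (congrFun h u))).2
  · obtain ⟨-, h2, h3, h4⟩ := mem_fillings.1 hf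
    choose x hx hfx hxu using fun u => h2 u (mem_univ u)
    obtain rfl : f = fun u => some (x u) := funext hfx
    have hxinj : Function.Injective x := fun u u' h => h3 u u' (x u) rfl (by rw [h])
    -- Compatibility enters here: equal cardinalities make the injective filling surjective, so the
    -- root slot and every prescribed label are used.
    have hcard : #(slots ρ E) = #(univ : Finset (Vertex n)) := by
      rw [card_eq_sum_card_fiberwise (f := Prod.fst) (t := univ) (by simp),
        card_eq_sum_card_fiberwise (s := univ) (f := Sigma.fst) (t := univ) (by simp)]
      refine sum_congr rfl fun s _ => ?_
      rw [card_filter_slots_fst, card_filter_fst_eq, hc s]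
      simp only [hE]
    have hsurj : ∀ y ∈ slots ρ E, ∃ u, x u = y := by
      have := eq_of_subset_of_card_le (s := univ.image x) (t := slots ρ E)
        (fun y hy => by obtain ⟨u, -, rfl⟩ := mem_image.1 hy; exact hx u)
        (by rw [card_image_of_injective _ hxinj, hcard])
      intro y hy
      obtain ⟨u, -, hu⟩ := mem_image.1 (this.symm ▸ hy)
      exact ⟨u, hu⟩
    obtain ⟨r, hr⟩ := hsurj (ρ, none) (by simp)
    have hslot : ∀ u, x u = (u.1, (x u).2) := fun u => Prod.ext (hxu u) rfl
    have hroot : ∀ u, (x u).2 = none ↔ u = r := by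
      refine fun u => ⟨fun hu => hxinj ?_, ?_⟩
      · have h := hx u
        rw [hslot u, hu, mk_none_mem_slots] at h
        rw [hslot u, hu, h, hr]
      · rintro rfl
        rw [hr]
    obtain ⟨T, hT, hTr⟩ := AcyclicMap.exists_rootedTree (p := fun u => (x u).2) h4 hroot
    have hT (u) : T.parent u = (x u).2 := congrFun hT u
    have hlabels : parentLabels T = E := by
      ext s t j
      simp only [mem_parentLabels, hT]
      constructor
      · rintro ⟨u, hu, rfl⟩
        have h := hx u
        rwa [hslot u, hu, mk_some_mem_slots] at h
      · intro hj
        obtain ⟨u, hu⟩ := hsurj (s, some ⟨t, j⟩) (mk_some_mem_slots.2 hj)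
        exact ⟨u, by simp [hu], by rw [← hxu u, hu]⟩
    refine ⟨T, mem_filter.2 ⟨mem_injectiveTrees.2 ⟨?_, ?_, by rw [hlabels]; exact hE⟩, hlabels⟩, ?_⟩
    · rw [hTr, ← hxu r, hr]
    · refine isInjective_iff.2 fun u u' v hu hu' h => hxinj ?_
      rw [hslot u, ← hT, hslot u', ← hT, h, hu, hu']
    · exact funext fun u => by rw [hT, ← hslot u]

theorem card_injectiveTrees (hn : ∀ t, 0 < n t) (hc : Compatible n ρ m) :
    #(injectiveTrees n ρ m) =
      (∏ s, ∏ t, (n t).choose (m s t)) * (∏ s, (n s - 1).factorial) *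
        ∑ A ∈ cayleyTrees d ρ, ∏ e ∈ A.arcs, m e.1 e.2 := by
  have hmaps : ∀ T ∈ injectiveTrees n ρ m, parentLabels T ∈
      Fintype.piFinset fun s => Fintype.piFinset fun t =>
        powersetCard (m s t) (univ : Finset (Fin (n t))) := by
    intro T hT
    simpa [mem_powersetCard] using (mem_injectiveTrees.1 hT).2.2
  -- Positivity of `n` makes every type occur, so selections range over all of `[d]`.
  have himg : (univ : Finset (Vertex n)).image Sigma.fst = univ :=
    eq_univ_of_forall fun t => mem_image.2 ⟨⟨t, 0, hn t⟩, mem_univ _, rfl⟩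
  -- The count for fixed `E` depends only on the sizes `m s t`, so the sum over `E` is a
  -- multiplication.
  rw [card_eq_sum_card_fiberwise hmaps, sum_congr rfl (g := fun _ =>
    (∏ s, (n s - 1).factorial) * ∑ A ∈ cayleyTrees d ρ, ∏ e ∈ A.arcs, m e.1 e.2), sum_const]
  · simp [Fintype.card_piFinset, mul_assoc]
  · intro E hE
    have hE : ∀ s t, #(E s t) = m s t := by simpa [mem_powersetCard] using hE
    rw [card_filter_injectiveTrees hc hE, card_fillings _ (by simp), himg, card_selections_slots]
    · simp only [card_filter_fst_eq, hE]
    · intro s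
      rw [card_filter_slots_fst, card_filter_fst_eq, hc s]
      simp only [hE]

end Trees

end MultitypeCayley

theorem mainTheorem9 {d : ℕ} (n : Fin d → ℕ) (hn : ∀ t, 0 < n t) (ρ : Fin d)
    (m : Fin d → Fin d → ℕ) :
    (MultitypeCayley.Compatible n ρ m →
      (MultitypeCayley.injectiveTrees n ρ m).card =
        (∏ s, ∏ t, (n t).choose (m s t)) * (∏ s, (n s - 1).factorial) *
          ∑ A ∈ MultitypeCayley.cayleyTrees d ρ, ∏ e ∈ A.arcs, m e.1 e.2) ∧
    (¬ MultitypeCayley.Compatible n ρ m →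
      (MultitypeCayley.injectiveTrees n ρ m).card = 0) :=
  ⟨MultitypeCayley.card_injectiveTrees hn, fun hc => Finset.card_eq_zero.2 <|
    Finset.eq_empty_of_forall_notMem fun _ hT =>
      hc (MultitypeCayley.compatible_of_mem_injectiveTrees hT)⟩
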